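/- **Setting.** Consider a controllable LTI system $x(k+1)=Ax(k)+Bu(k)$, $y(k)=Cx(k)+Du(k)$ with $x(k)\in\mathbb R^n$, $u(k)\in\mathbb R^m$, $y(k)\in\mathbb R^p$. Let $N\ge 1$, let $T_{\rm ini}$ be at least the lag of the system (the least $\ell$ for which $\operatorname{rank}\,\mathrm{col}(C,CA,\dots,CA^{\ell-1})=\operatorname{rank}\,\mathrm{col}(C,CA,\dots,CA^{n-1})$), and put $L=T_{\rm ini}+N$. Let $(u_{\rm d},y_{\rm d})$ be a (noise-free) input/output trajectory of length $T$ of the system whose input is persistently exciting of order $L+n$ (that is, $L+n<T$ and the depth-$(L+n)$ Hankel matrix of $u_{\rm d}$ has full row rank). Write the depth-$L$ Hankel matrices as $H_u=\mathcal H_L(u_{\rm d})=\mathrm{col}(U_P,U_F)$ and $H_y=\mathcal H_L(y_{\rm d})=\mathrm{col}(Y_P,Y_F)$, where $P$ marks the first $T_{\rm ini}$ and $F$ the last $N$ block rows, and let $H=\mathrm{col}(U_P,Y_P,U_F,Y_F)$. Let $R\succ0$, $Q\succeq0$, let $\mathcal U\subseteq\mathbb R^m$ and $\mathcal Y\subseteq\mathbb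 R^p$ be convex, and let $u_{\rm ini}\in\mathbb R^{mT_{\rm ini}}$, $y_{\rm ini}\in\mathbb R^{pT_{\rm ini}}$ be arbitrary. For a matrix $K=\mathrm{col}(K_1,K_2)$, partitioned like $H=\mathrm{col}(H_1,Y_F)$ with $H_1=\mathrm{col}(U_P,Y_P,U_F)$, and for $\lambda_1,\lambda_2,\lambda_y\in\mathbb R$, consider the problem $$\min_{g,\sigma_y,u,y}\ \sum_{k}u(k)^{\mathsf T}Ru(k)+\sum_k y(k)^{\mathsf T}Qy(k)+\lambda_1\|g\|_1+\lambda_2\|(I-K_1^\dagger K_1)g\|_2^2+\lambda_y\|\sigma_y\|_2^2$$ $$\text{subject to } Kg=\mathrm{col}(u_{\rm ini},\,y_{\rm ini}+\sigma_y,\,u,\,y),\qquad u(k)\in\mathcal U,\ y(k)\in\mathcal Y\ \ (k=1,\dots,N).$$ * *DeePC-Hybrid*: $K=H$. * *DeePC-SVD*: $K=W\Sigma$ for a compact singular value decomposition $H=W\Sigma V^{\mathsf T}$. * *Data-Driven-SPC*: $K=\mathrm{col}(U_P,Y_P,U_F,Y_F\Pi_1)$ with $\Pi_1=H_1^\dagger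 H_1$, and no $\lambda_2$-term. * *DeePC-SVD-Iter*: $K=\tilde W_r\tilde\Sigma_r$ consists of the leading $mL+n$ singular values and left singular vectors (all those with non-zero singular value, if there are fewer) of $\mathrm{col}(U_P,Y_P^*,U_F,Y_F^*)$, and there is no $\lambda_1$-term. Here $\mathrm{col}(Y_P^*,Y_F^*)$ is an output of the following iteration, with $\Pi_2=H_u^\dagger H_u$, some tolerance $\varepsilon\ge0$ and some matrix norm: start with $Z=H_y$; repeat $Y\leftarrow Z\Pi_2+[Z(I-\Pi_2)]_n$, $Z\leftarrow\Pi_{\rm H}(Y)$ until $\|Z-Y\|\le\varepsilon\|Z\|$; return $Y$. ($[\,\cdot\,]_n$ is the truncation of a singular value decomposition to the $n$ leading terms, and $\Pi_{\rm H}$ averages over block skew-diagonals.) **Claim.** Take $\lambda_1=\lambda_2=0$, and restrict all problems to $\sigma_y=0$. Then the iteration in DeePC-SVD-Iter has an output, and, whatever singular value decompositions are used and whichever output is taken, DeePC-Hybrid, DeePC-SVD, Data-Driven-SPC and DeePC-SVD-Iter have the same set of optimal solutions $(u^*,y^*)$. This set has at most one element, and it has exactly one if $\mathcal U$ and $\mathcal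 Y$ are closed and the problem DeePC-Hybrid with $\sigma_y=0$ is feasible. -/

import Mathlib

open Matrix

noncomputable section

namespace DeePC

/-! ### Compact singular value decomposition and pseudo-inverse -/

/-- A compact singular value decomposition `A = W Σ Vᵀ`: `Σ = diag (σ₁ ≥ ⋯ ≥ σᵣ > 0)`, and the
columns of `W` and of `V` are orthonormal. -/
structure CompactSVD {I J : Type} [Fintype I] [Fintype J] (A : Matrix I J ℝ) where
  r : ℕ
  W : Matrix I (Fin r) ℝ
  sv : Fin r → ℝ
  V : Matrix J (Fin r) ℝ
  sv_pos : ∀ i, 0 < sv i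
  sv_antitone : Antitone sv
  W_orthonormal : Wᵀ * W = 1
  V_orthonormal : Vᵀ * V = 1
  eq_mul : A = W * diagonal sv * Vᵀ

/-- Every real matrix has a compact singular value decomposition. -/
theorem exists_compactSVD {I J : Type} [Fintype I] [Fintype J] (A : Matrix I J ℝ) :
    Nonempty (CompactSVD A) := by
  classical
  have hB : (Aᵀ * A).IsHermitian := by
    simpa [conjTranspose_eq_transpose_of_trivial] using isHermitian_conjTranspose_mul_self A
  have hpsd : (Aᵀ * A).PosSemidef := by
    simpa [conjTranspose_eq_transpose_of_trivial] using posSemidef_conjTranspose_mul_self A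
  -- an orthogonal matrix of eigenvectors, indexed so that the eigenvalues decrease
  obtain ⟨d, V0, l, hl, hl0, hVV, hVV', hD⟩ : ∃ (d : ℕ) (V0 : Matrix J (Fin d) ℝ) (l : Fin d → ℝ),
      Antitone l ∧ (∀ i, 0 ≤ l i) ∧ V0ᵀ * V0 = 1 ∧ V0 * V0ᵀ = 1 ∧
        V0ᵀ * (Aᵀ * A) * V0 = diagonal l := by
    let e : Fin (Fintype.card J) ≃ J := Fintype.equivOfCardEq (Fintype.card_fin _)
    let U : Matrix J J ℝ := hB.eigenvectorUnitary
    have hU1 : Uᵀ * U = 1 := by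
      have := Unitary.coe_star_mul_self hB.eigenvectorUnitary
      simpa [star_eq_conjTranspose, conjTranspose_eq_transpose_of_trivial] using this
    have hU2 : U * Uᵀ = 1 := mul_eq_one_comm.mp hU1
    have hUD : Uᵀ * (Aᵀ * A) * U = diagonal hB.eigenvalues := by
      have h := hB.spectral_theorem
      rw [Unitary.conjStarAlgAut_apply] at h
      have h' : Aᵀ * A = U * diagonal hB.eigenvalues * Uᵀ := by
        simpa [star_eq_conjTranspose, conjTranspose_eq_transpose_of_trivial] using h
      calc Uᵀ * (Aᵀ * A) * U = Uᵀ * (U * diagonal hB.eigenvalues * Uᵀ) * U :=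
            congrArg (fun M => Uᵀ * M * U) h'
        _ = (Uᵀ * U) * diagonal hB.eigenvalues * (Uᵀ * U) := by simp only [Matrix.mul_assoc]
        _ = _ := by rw [hU1]; simp
    refine ⟨Fintype.card J, U.submatrix id e, hB.eigenvalues₀, hB.eigenvalues₀_antitone,
      fun i => ?_, ?_, ?_, ?_⟩
    · have := hpsd.eigenvalues_nonneg (e i)
      simpa [IsHermitian.eigenvalues, e] using this
    · rw [transpose_submatrix, submatrix_mul _ _ _ id _ Function.bijective_id |>.symm, hU1]
      simp
    · rw [transpose_submatrix, submatrix_mul _ _ _ e _ e.bijective |>.symm, hU2]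
      simp
    · have : (U.submatrix id e)ᵀ * (Aᵀ * A) * U.submatrix id e
          = (Uᵀ * (Aᵀ * A) * U).submatrix e e := by
        ext i j; simp [Matrix.mul_apply]
      rw [this, hUD, submatrix_diagonal_equiv]
      congr 1
      ext i
      simp [IsHermitian.eigenvalues, e]
  -- the number of positive eigenvalues
  let r : ℕ := (Finset.univ.filter fun i : Fin d => 0 < l i).card
  have hr : ∀ i : Fin d, (i : ℕ) < r ↔ 0 < l i := by
    intro i
    constructor
    · intro hi
      by_contra hn
      have hsub : (Finset.univ.filter fun k : Fin d => 0 < l k) ⊆ Finset.Iio i := by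
        intro k hk
        rw [Finset.mem_Iio]
        by_contra hki
        have h1 := hl (not_lt.mp hki)
        have h2 : 0 < l k := by simpa using hk
        linarith
      have := Finset.card_le_card hsub
      rw [Fin.card_Iio] at this
      omega
    · intro hi
      have hsub : Finset.Iic i ⊆ (Finset.univ.filter fun k : Fin d => 0 < l k) := by
        intro k hk
        have h1 := hl (Finset.mem_Iic.mp hk)
        simp only [Finset.mem_filter, Finset.mem_univ, true_and]
        linarith
      have := Finset.card_le_card hsub
      rw [Fin.card_Iic] at this
      omega
  have hrd : r ≤ d := by simpa using Finset.card_filter_le Finset.univ fun i : Fin d => 0 < l i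
  let c : Fin r → Fin d := Fin.castLE hrd
  have hc : Function.Injective c := Fin.castLE_injective hrd
  have hlc : ∀ i, 0 < l (c i) := fun i => (hr _).mp i.2
  have hs : ∀ i, 0 < Real.sqrt (l (c i)) := fun i => Real.sqrt_pos.mpr (hlc i)
  have hG : ∀ i j, ∑ x, (A * V0) x i * (A * V0) x j = if i = j then l i else 0 := by
    intro i j
    have h := congrFun (congrFun hD i) j
    have h2 : V0ᵀ * (Aᵀ * A) * V0 = (A * V0)ᵀ * (A * V0) := by
      rw [transpose_mul]; simp only [Matrix.mul_assoc]
    rw [h2, Matrix.mul_apply, diagonal_apply] at h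
    simpa using h
  have hzero : ∀ (x : I) (i : Fin d), ¬ (i : ℕ) < r → (A * V0) x i = 0 := by
    intro x i hi
    have h0 : l i = 0 := le_antisymm (not_lt.mp fun h => hi ((hr i).mpr h)) (hl0 i)
    have h := hG i i
    rw [if_pos rfl, h0, Finset.sum_eq_zero_iff_of_nonneg fun _ _ => mul_self_nonneg _] at h
    exact mul_self_eq_zero.mp (h x (Finset.mem_univ x))
  refine ⟨⟨r, of fun x i => (A * V0) x (c i) / Real.sqrt (l (c i)), fun i => Real.sqrt (l (c i)),
    V0.submatrix id c, hs, ?_, ?_, ?_, ?_⟩⟩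
  · intro i j hij
    exact Real.sqrt_le_sqrt (hl hij)
  · ext i j
    have h1 : ∑ x, ((A * V0) x (c i) / Real.sqrt (l (c i))) *
        ((A * V0) x (c j) / Real.sqrt (l (c j)))
        = (∑ x, (A * V0) x (c i) * (A * V0) x (c j)) /
          (Real.sqrt (l (c i)) * Real.sqrt (l (c j))) := by
      rw [Finset.sum_div]
      exact Finset.sum_congr rfl fun x _ => by rw [div_mul_div_comm]
    rw [Matrix.mul_apply]
    simp only [transpose_apply, of_apply]
    rw [h1, hG, Matrix.one_apply]
    by_cases hij : i = j
    · subst hij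
      rw [if_pos rfl, if_pos rfl, Real.mul_self_sqrt (hlc i).le, div_self (hlc i).ne']
    · rw [if_neg (fun h => hij (hc h)), if_neg hij, zero_div]
  · ext i j
    have h := congrFun (congrFun hVV (c i)) (c j)
    rw [Matrix.mul_apply] at h ⊢
    simp only [transpose_apply, submatrix_apply, id] at h ⊢
    rw [h, Matrix.one_apply, Matrix.one_apply]
    by_cases hij : i = j
    · subst hij; simp
    · rw [if_neg (fun h => hij (hc h)), if_neg hij]
  · have hA : A = (A * V0) * V0ᵀ := by rw [Matrix.mul_assoc, hVV', Matrix.mul_one]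
    ext x y
    conv_lhs => rw [hA]
    rw [Matrix.mul_apply, Matrix.mul_apply]
    simp only [mul_diagonal, transpose_apply, submatrix_apply, id, of_apply]
    have hsum : ∑ i : Fin d, (A * V0) x i * V0 y i
        = ∑ i ∈ Finset.univ.map ⟨c, hc⟩, (A * V0) x i * V0 y i := by
      symm
      apply Finset.sum_subset (Finset.subset_univ _)
      intro i _ hi
      rw [hzero x i, zero_mul]
      intro hir
      exact hi (Finset.mem_map.mpr ⟨⟨i, hir⟩, Finset.mem_univ _, rfl⟩)
    rw [hsum, Finset.sum_map]
    refine Finset.sum_congr rfl fun i _ => ?_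
    simp only [Function.Embedding.coeFn_mk]
    rw [div_mul_cancel₀ _ (hs i).ne']

/-- The four Penrose equations: `X` is the pseudo-inverse of `A`. -/
structure IsPseudoInverse {I J : Type} [Fintype I] [Fintype J] (A : Matrix I J ℝ)
    (X : Matrix J I ℝ) : Prop where
  mul_mul_self : A * X * A = A
  mul_mul_inv : X * A * X = X
  symm_left : (A * X)ᵀ = A * X
  symm_right : (X * A)ᵀ = X * A

theorem exists_isPseudoInverse {I J : Type} [Fintype I] [Fintype J] (A : Matrix I J ℝ) :
    ∃ X, IsPseudoInverse A X := by
  obtain ⟨S⟩ := exists_compactSVD A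
  obtain ⟨r, W, s, V, hs, -, hW, hV, hA⟩ := S
  have h1 : diagonal s * diagonal (fun i => (s i)⁻¹) = 1 := by
    rw [diagonal_mul_diagonal, ← diagonal_one]
    congr 1; ext i; exact mul_inv_cancel₀ (hs i).ne'
  have h2 : diagonal (fun i => (s i)⁻¹) * diagonal s = 1 := by
    rw [diagonal_mul_diagonal, ← diagonal_one]
    congr 1; ext i; exact inv_mul_cancel₀ (hs i).ne'
  have hAX : A * (V * diagonal (fun i => (s i)⁻¹) * Wᵀ) = W * Wᵀ := by
    calc A * (V * diagonal (fun i => (s i)⁻¹) * Wᵀ)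
        = W * (diagonal s * ((Vᵀ * V) * diagonal (fun i => (s i)⁻¹))) * Wᵀ := by
          rw [hA]; simp only [Matrix.mul_assoc]
      _ = _ := by rw [hV, Matrix.one_mul, h1, Matrix.mul_one]
  have hXA : (V * diagonal (fun i => (s i)⁻¹) * Wᵀ) * A = V * Vᵀ := by
    calc (V * diagonal (fun i => (s i)⁻¹) * Wᵀ) * A
        = V * (diagonal (fun i => (s i)⁻¹) * ((Wᵀ * W) * diagonal s)) * Vᵀ := by
          rw [hA]; simp only [Matrix.mul_assoc]
      _ = _ := by rw [hW, Matrix.one_mul, h2, Matrix.mul_one]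
  refine ⟨V * diagonal (fun i => (s i)⁻¹) * Wᵀ, ?_, ?_, ?_, ?_⟩
  · rw [hAX, hA]
    calc W * Wᵀ * (W * diagonal s * Vᵀ) = W * (Wᵀ * W) * diagonal s * Vᵀ := by
          simp only [Matrix.mul_assoc]
      _ = _ := by rw [hW, Matrix.mul_one]
  · rw [hXA]
    calc V * Vᵀ * (V * diagonal (fun i => (s i)⁻¹) * Wᵀ)
        = V * (Vᵀ * V) * diagonal (fun i => (s i)⁻¹) * Wᵀ := by simp only [Matrix.mul_assoc]
      _ = _ := by rw [hV, Matrix.mul_one]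
  · rw [hAX, transpose_mul, transpose_transpose]
  · rw [hXA, transpose_mul, transpose_transpose]

/-- The Moore-Penrose pseudo-inverse `A†` (it is unique). -/
def pinv {I J : Type} [Fintype I] [Fintype J] (A : Matrix I J ℝ) : Matrix J I ℝ :=
  Classical.choose (exists_isPseudoInverse A)

/-- `A† A`, the orthogonal projector onto the row space of `A`. -/
def rowProj {I J : Type} [Fintype I] [Fintype J] (A : Matrix I J ℝ) : Matrix J J ℝ :=
  pinv A * A

namespace CompactSVD

variable {I J : Type} [Fintype I] [Fintype J] {A : Matrix I J ℝ}

/-- `W Σ`. -/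
def factor (S : CompactSVD A) : Matrix I (Fin S.r) ℝ :=
  S.W * diagonal S.sv

/-- `Wₖ Σₖ`, made of the leading `k` singular values and left singular vectors (of all of them, if
there are at most `k`). -/
def leadingFactor (S : CompactSVD A) (k : ℕ) : Matrix I (Fin (min k S.r)) ℝ :=
  S.factor.submatrix id (Fin.castLE (min_le_right k S.r))

/-- The truncated sum `∑_{i ≤ k} σᵢ wᵢ vᵢᵀ`; terms with zero singular value do not contribute. -/
def truncation (S : CompactSVD A) (k : ℕ) : Matrix I J ℝ :=
  ∑ i : Fin S.r, if (i : ℕ) < k then S.sv i • vecMulVec (S.W.col i) (S.V.col i) else 0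

end CompactSVD

/-! ### Linear time-invariant systems, trajectories, Hankel matrices -/

/-- `x(k+1) = A x(k) + B u(k)`, `y(k) = C x(k) + D u(k)` with state, input and output dimensions
`n`, `m`, `p`. -/
structure LTISystem (n m p : ℕ) where
  A : Matrix (Fin n) (Fin n) ℝ
  B : Matrix (Fin n) (Fin m) ℝ
  C : Matrix (Fin p) (Fin n) ℝ
  D : Matrix (Fin p) (Fin m) ℝ

namespace LTISystem

variable {n m p : ℕ}

/-- The controllability matrix `[B, A B, …, Aⁿ⁻¹ B]`. -/
def controllabilityMatrix (S : LTISystem n m p) : Matrix (Fin n) (Fin n × Fin m) ℝ :=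
  of fun i k => (S.A ^ (k.1 : ℕ) * S.B) i k.2

def IsControllable (S : LTISystem n m p) : Prop :=
  S.controllabilityMatrix.rank = n

/-- The extended observability matrix `col(C, C A, …, C A^(l-1))`. -/
def observabilityMatrix (S : LTISystem n m p) (l : ℕ) : Matrix (Fin l × Fin p) (Fin n) ℝ :=
  of fun k j => (S.C * S.A ^ (k.1 : ℕ)) k.2 j

/-- The lag: the least `l` at which the rank of the extended observability matrix reaches its
maximal value, the one at `l = n` (which is `n` if the system is observable). -/
def lag (S : LTISystem n m p) : ℕ :=
  sInf {l : ℕ | (S.observabilityMatrix l).rank = (S.observabilityMatrix n).rank}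

/-- `(u(0), …, u(T-1))`, `(y(0), …, y(T-1))` is an input/output trajectory of length `T`;
the values of `u` and `y` from time `T` on are irrelevant. -/
def IsTrajectory (S : LTISystem n m p) (T : ℕ) (u : ℕ → Fin m → ℝ) (y : ℕ → Fin p → ℝ) : Prop :=
  ∃ x : ℕ → Fin n → ℝ, ∀ k < T,
    x (k + 1) = S.A *ᵥ x k + S.B *ᵥ u k ∧ y k = S.C *ᵥ x k + S.D *ᵥ u k

end LTISystem

/-- The depth-`L` block Hankel matrix of a signal `ω(0), …, ω(T-1)` of length `T ≥ L`. Rows are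
indexed by block and component, columns by `0, …, T-L`. -/
def hankel {q : ℕ} (L T : ℕ) (ω : ℕ → Fin q → ℝ) :
    Matrix (Fin L × Fin q) (Fin (T - L + 1)) ℝ :=
  of fun i j => ω (i.1 + j) i.2

/-- Persistency of excitation of order `L` of a signal of length `T`: `L < T` and the depth-`L`
Hankel matrix has full row rank. -/
def PersistentlyExciting {q : ℕ} (L T : ℕ) (ω : ℕ → Fin q → ℝ) : Prop :=
  L < T ∧ LinearIndependent ℝ (hankel L T ω).row

/-! ### The data matrix and its partition -/

/-- The first `a` block rows. -/
def pastRows {a b q : ℕ} {J : Type} (M : Matrix (Fin (a + b) × Fin q) J ℝ) :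
    Matrix (Fin a × Fin q) J ℝ :=
  M.submatrix (fun i => (Fin.castAdd b i.1, i.2)) id

/-- The last `b` block rows. -/
def futureRows {a b q : ℕ} {J : Type} (M : Matrix (Fin (a + b) × Fin q) J ℝ) :
    Matrix (Fin b × Fin q) J ℝ :=
  M.submatrix (fun i => (Fin.natAdd a i.1, i.2)) id

/-- Row indices of `col(U_P, Y_P, U_F)`. -/
abbrev Rows₁ (m p Tini N : ℕ) : Type :=
  (Fin Tini × Fin m) ⊕ ((Fin Tini × Fin p) ⊕ (Fin N × Fin m))

/-- Row indices of `col(U_P, Y_P, U_F, Y_F)`. -/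
abbrev Rows (m p Tini N : ℕ) : Type :=
  Rows₁ m p Tini N ⊕ (Fin N × Fin p)

section Predictor

variable {m p Tini N : ℕ} {J : Type}

/-- `col(U_P, Y_P, U_F, Y_F)`, formed from `Hu = col(U_P, U_F)` and `Hy = col(Y_P, Y_F)`. -/
def dataMatrix (Hu : Matrix (Fin (Tini + N) × Fin m) J ℝ)
    (Hy : Matrix (Fin (Tini + N) × Fin p) J ℝ) : Matrix (Rows m p Tini N) J ℝ :=
  fromRows (fromRows (pastRows Hu) (fromRows (pastRows Hy) (futureRows Hu))) (futureRows Hy)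

/-- `col(U_P, Y_P, U_F, M)` with `M = Y_F Π₁`, the row-wise orthogonal projection of `Y_F` onto the
row space of `H₁ = col(U_P, Y_P, U_F)`. -/
def spcMatrix [Fintype J] (H : Matrix (Rows m p Tini N) J ℝ) : Matrix (Rows m p Tini N) J ℝ :=
  fromRows H.toRows₁ (H.toRows₂ * rowProj H.toRows₁)

end Predictor

/-! ### Iterative structured low-rank approximation -/

section SLRA

variable {L p c : ℕ}

/-- Projection onto the block Hankel matrices, by averaging over each block skew-diagonal. -/
def hankelProj (M : Matrix (Fin L × Fin p) (Fin c) ℝ) : Matrix (Fin L × Fin p) (Fin c) ℝ :=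
  of fun i j =>
    let s := Finset.univ.filter fun q : Fin L × Fin c => (q.1 : ℕ) + q.2 = i.1 + j
    (∑ q ∈ s, M (q.1, i.2) q.2) / (s.card : ℝ)

/-- `Y` is a result `Z Π₂ + ∑_{i ≤ n} σᵢ uᵢ vᵢᵀ` of the SVD step at `Z`, for some singular value
decomposition of `Z (I - Π₂)`. -/
def IsSVDStep (P₂ : Matrix (Fin c) (Fin c) ℝ) (n : ℕ)
    (Z Y : Matrix (Fin L × Fin p) (Fin c) ℝ) : Prop :=
  ∃ S : CompactSVD (Z * (1 - P₂)), Y = Z * P₂ + S.truncation n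

/-- `IterSLRA ν P₂ n ε Z Y`: the loop "`Y ← SVD step at Z`, `Z ← hankelProj Y`, until
`ν (Z - Y) ≤ ε ν Z`", entered with the value `Z`, can terminate with the output `Y`. Here `ν` is
the matrix norm of the stopping test. -/
inductive IterSLRA (ν : Seminorm ℝ (Matrix (Fin L × Fin p) (Fin c) ℝ))
    (P₂ : Matrix (Fin c) (Fin c) ℝ) (n : ℕ) (ε : ℝ) :
    Matrix (Fin L × Fin p) (Fin c) ℝ → Matrix (Fin L × Fin p) (Fin c) ℝ → Prop
  | finish (Z Y : Matrix (Fin L × Fin p) (Fin c) ℝ) :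
      IsSVDStep P₂ n Z Y → ν (hankelProj Y - Y) ≤ ε * ν (hankelProj Y) →
      IterSLRA ν P₂ n ε Z Y
  | again (Z Y Out : Matrix (Fin L × Fin p) (Fin c) ℝ) :
      IsSVDStep P₂ n Z Y → ¬ ν (hankelProj Y - Y) ≤ ε * ν (hankelProj Y) →
      IterSLRA ν P₂ n ε (hankelProj Y) Out → IterSLRA ν P₂ n ε Z Out

end SLRA

/-! ### The predictive control problems -/

/-- The control specification: weights, constraint sets, and the most recent past
input/output data. -/
structure ControlSpec (m p Tini : ℕ) where
  R : Matrix (Fin m) (Fin m) ℝ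
  Q : Matrix (Fin p) (Fin p) ℝ
  U : Set (Fin m → ℝ)
  Y : Set (Fin p → ℝ)
  uIni : Fin Tini → Fin m → ℝ
  yIni : Fin Tini → Fin p → ℝ

section Problems

variable {m p Tini N : ℕ} {J : Type} [Fintype J] [DecidableEq J]

/-- `∑ₖ v(k)ᵀ M v(k)`. -/
def quadCost {q : ℕ} (M : Matrix (Fin q) (Fin q) ℝ) (v : Fin N → Fin q → ℝ) : ℝ :=
  ∑ k, v k ⬝ᵥ M *ᵥ v k

/-- `col(u_ini, y_ini + σ, u, y)`. -/
def stacked (spec : ControlSpec m p Tini) (σ : Fin Tini → Fin p → ℝ)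
    (u : Fin N → Fin m → ℝ) (y : Fin N → Fin p → ℝ) : Rows m p Tini N → ℝ :=
  Sum.elim
    (Sum.elim (fun i => spec.uIni i.1 i.2)
      (Sum.elim (fun i => spec.yIni i.1 i.2 + σ i.1 i.2) (fun i => u i.1 i.2)))
    (fun i => y i.1 i.2)

/-- `(g, σ, u, y)` satisfies all constraints of the problem with predictor matrix `K`. -/
def IsFeasible (spec : ControlSpec m p Tini) (K : Matrix (Rows m p Tini N) J ℝ)
    (g : J → ℝ) (σ : Fin Tini → Fin p → ℝ) (u : Fin N → Fin m → ℝ) (y : Fin N → Fin p → ℝ) :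
    Prop :=
  (∀ k, u k ∈ spec.U) ∧ (∀ k, y k ∈ spec.Y) ∧ K *ᵥ g = stacked spec σ u y

/-- `‖u‖_R² + ‖y‖_Q² + λ₁ ‖g‖₁ + λ₂ ‖(I - Π₁) g‖₂² + λ_y ‖σ‖₂²`, where `Π₁ = K₁† K₁` and `K₁`
consists of the first three blocks of `K`. -/
def cost (spec : ControlSpec m p Tini) (K : Matrix (Rows m p Tini N) J ℝ) (lam₁ lam₂ lamY : ℝ)
    (g : J → ℝ) (σ : Fin Tini → Fin p → ℝ) (u : Fin N → Fin m → ℝ) (y : Fin N → Fin p → ℝ) : ℝ :=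
  quadCost spec.R u + quadCost spec.Q y + lam₁ * ∑ j, |g j|
    + lam₂ * ∑ j, (((1 - rowProj K.toRows₁) *ᵥ g) j) ^ 2 + lamY * ∑ k, ∑ i, σ k i ^ 2

/-- The `(u, y)`-parts of the minimizers over `(g, σ, u, y)` of the problem with predictor matrix
`K`, with the slack `σ` ranging over `slack` (`Set.univ` for a free slack, `{0}` for none). -/
def optimalSet (spec : ControlSpec m p Tini) (slack : Set (Fin Tini → Fin p → ℝ))
    (K : Matrix (Rows m p Tini N) J ℝ) (lam₁ lam₂ lamY : ℝ) :
    Set ((Fin N → Fin m → ℝ) × (Fin N → Fin p → ℝ)) :=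
  {z | ∃ g, ∃ σ ∈ slack, IsFeasible spec K g σ z.1 z.2 ∧
    ∀ g', ∀ σ' ∈ slack, ∀ u' y', IsFeasible spec K g' σ' u' y' →
      cost spec K lam₁ lam₂ lamY g σ z.1 z.2 ≤ cost spec K lam₁ lam₂ lamY g' σ' u' y'}

/-- DeePC-Hybrid with data matrix `H`. -/
def hybridSol (spec : ControlSpec m p Tini) (slack : Set (Fin Tini → Fin p → ℝ))
    (H : Matrix (Rows m p Tini N) J ℝ) (lam₁ lam₂ lamY : ℝ) :
    Set ((Fin N → Fin m → ℝ) × (Fin N → Fin p → ℝ)) :=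
  optimalSet spec slack H lam₁ lam₂ lamY

/-- DeePC-SVD: the predictor matrix is `W Σ`, for the decomposition `H = W Σ Vᵀ`. -/
def svdSol (spec : ControlSpec m p Tini) (slack : Set (Fin Tini → Fin p → ℝ))
    {H : Matrix (Rows m p Tini N) J ℝ} (S : CompactSVD H) (lam₁ lam₂ lamY : ℝ) :
    Set ((Fin N → Fin m → ℝ) × (Fin N → Fin p → ℝ)) :=
  optimalSet spec slack S.factor lam₁ lam₂ lamY

/-- Data-Driven-SPC: the predictor matrix is `col(U_P, Y_P, U_F, Y_F Π₁)`, and there is no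
`λ₂`-term. -/
def spcSol (spec : ControlSpec m p Tini) (slack : Set (Fin Tini → Fin p → ℝ))
    (H : Matrix (Rows m p Tini N) J ℝ) (lam₁ lamY : ℝ) :
    Set ((Fin N → Fin m → ℝ) × (Fin N → Fin p → ℝ)) :=
  optimalSet spec slack (spcMatrix H) lam₁ 0 lamY

/-- DeePC-SVD-Iter for a system of order `n`: the predictor matrix consists of the leading
`m L + n` singular values and left singular vectors (`L = Tini + N`) of the matrix
`Hs = col(U_P, Y_P*, U_F, Y_F*)`, in which `col(Y_P*, Y_F*)` is the output of the iterative
low-rank approximation; there is no `λ₁`-term. -/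
def svdIterSol (n : ℕ) (spec : ControlSpec m p Tini) (slack : Set (Fin Tini → Fin p → ℝ))
    {Hs : Matrix (Rows m p Tini N) J ℝ} (S : CompactSVD Hs) (lam₂ lamY : ℝ) :
    Set ((Fin N → Fin m → ℝ) × (Fin N → Fin p → ℝ)) :=
  optimalSet spec slack (S.leadingFactor (m * (Tini + N) + n)) 0 lam₂ lamY

end Problems

end DeePC

end

/-!
For exact data all four predictor matrices have the same column space, and without regularization
and slack the problem depends on the predictor matrix through its column space alone
(`optimalSet_congr`).

Everything about the data follows from one observation (`hankel_mulVec_eq_free_response`): if `g`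
lies in the kernel of the input Hankel matrix `H_u`, then `H_y g` is the free response of the
system to the state `X g`, where `X` is the matrix of the offline states. Hence:

* `H_y (I - Π₂)` has rank at most `n`, so the truncation in the iterative approximation changes
  nothing; since `H_y` is already block Hankel, the loop stops in its first pass and returns `H_y`
  (`iterSLRA_hankel_iff`).
* The kernel of `col(H_u, X)` is contained in that of `H`, so `H` has rank at most `m L + n`, and the
  leading `m L + n` terms of its singular value decomposition are all of them.
* If `H₁ g = 0`, the first `Tini` outputs of the free response vanish. As `Tini` is at least the lag,
  the state `X g` is unobservable and `Y_F g = 0` (`toRows₂_mulVec_eq_zero`). Thus `Y_F Π₁ = Y_F`.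

The last point also makes `y` an affine function of `u` on the feasible set. As `R` is positive
definite, the cost is strictly convex and coercive in `u`, which gives uniqueness (by the
parallelogram identity at the midpoint of two optimizers) and existence.
-/

namespace DeePC

/-! ### Pseudo-inverses and singular value decompositions -/

section LinearAlgebra

variable {I J K : Type} [Fintype I] [Fintype J]

theorem mul_rowProj (A : Matrix I J ℝ) : A * rowProj A = A := by
  rw [rowProj, ← Matrix.mul_assoc]
  exact (Classical.choose_spec (exists_isPseudoInverse A)).mul_mul_self

theorem mulVec_one_sub_rowProj [DecidableEq J] (A : Matrix I J ℝ) (g : J → ℝ) :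
    A *ᵥ ((1 - rowProj A) *ᵥ g) = 0 := by
  rw [mulVec_mulVec, Matrix.mul_sub, mul_rowProj, Matrix.mul_one, sub_self, zero_mulVec]

theorem mul_rowProj_of_ker_le [DecidableEq J] (A : Matrix I J ℝ) (B : Matrix K J ℝ)
    (h : ∀ g, A *ᵥ g = 0 → B *ᵥ g = 0) : B * rowProj A = B := by
  have h1 : B * (1 - rowProj A) = 0 := by
    refine ext_of_mulVec_single fun j => ?_
    rw [← mulVec_mulVec, zero_mulVec]
    exact h _ (mulVec_one_sub_rowProj A _)
  rw [Matrix.mul_sub, Matrix.mul_one, sub_eq_zero] at h1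
  exact h1.symm

theorem rank_le_of_ker_le [DecidableEq J] (A : Matrix I J ℝ) (B : Matrix K J ℝ)
    (h : ∀ g, A *ᵥ g = 0 → B *ᵥ g = 0) : B.rank ≤ A.rank := by
  rw [← mul_rowProj_of_ker_le A B h, rowProj, ← Matrix.mul_assoc]
  exact rank_mul_le_right _ _

namespace CompactSVD

variable {A : Matrix I J ℝ}

theorem r_le_rank (S : CompactSVD A) : S.r ≤ A.rank := by
  have h1 : S.Wᵀ * A * S.V = diagonal S.sv := by
    calc S.Wᵀ * A * S.V = S.Wᵀ * (S.W * diagonal S.sv * S.Vᵀ) * S.V :=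
          congrArg (fun M => S.Wᵀ * M * S.V) S.eq_mul
      _ = (S.Wᵀ * S.W) * diagonal S.sv * (S.Vᵀ * S.V) := by simp only [Matrix.mul_assoc]
      _ = _ := by rw [S.W_orthonormal, S.V_orthonormal, Matrix.one_mul, Matrix.mul_one]
  have h2 : (diagonal S.sv).rank = S.r := by
    rw [rank_of_isUnit, Fintype.card_fin]
    rw [isUnit_diagonal, Pi.isUnit_iff]
    exact fun i => (S.sv_pos i).ne'.isUnit
  calc S.r = (S.Wᵀ * A * S.V).rank := by rw [h1, h2]
    _ ≤ (S.Wᵀ * A).rank := rank_mul_le_left _ _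
    _ ≤ A.rank := rank_mul_le_right _ _

theorem truncation_eq_self (S : CompactSVD A) {k : ℕ} (h : S.r ≤ k) : S.truncation k = A := by
  conv_rhs => rw [S.eq_mul]
  ext i j
  rw [truncation, Matrix.sum_apply, Matrix.mul_apply]
  refine Finset.sum_congr rfl fun l _ => ?_
  rw [if_pos (l.2.trans_le h)]
  simp only [Matrix.smul_apply, vecMulVec_apply, col_apply, mul_diagonal, transpose_apply,
    smul_eq_mul]
  ring

theorem range_factor (S : CompactSVD A) :
    Set.range (S.factor *ᵥ ·) = Set.range (A *ᵥ ·) := by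
  ext v
  constructor
  · rintro ⟨g, rfl⟩
    refine ⟨S.V *ᵥ g, ?_⟩
    have : A * S.V = S.factor := by
      calc A * S.V = (S.W * diagonal S.sv * S.Vᵀ) * S.V := congrArg (· * S.V) S.eq_mul
        _ = S.factor := by
          rw [Matrix.mul_assoc _ S.Vᵀ, S.V_orthonormal, Matrix.mul_one, factor]
    simp only [mulVec_mulVec, this]
  · rintro ⟨g, rfl⟩
    refine ⟨S.Vᵀ *ᵥ g, ?_⟩
    simp only [mulVec_mulVec]
    rw [factor, ← S.eq_mul]

theorem range_leadingFactor (S : CompactSVD A) {k : ℕ} (h : S.r ≤ k) :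
    Set.range (S.leadingFactor k *ᵥ ·) = Set.range (A *ᵥ ·) := by
  rw [← S.range_factor]
  have hk : min k S.r = S.r := min_eq_right h
  have h1 : S.leadingFactor k = S.factor.submatrix id (finCongr hk) := rfl
  have h2 : ∀ g, S.leadingFactor k *ᵥ g = S.factor *ᵥ (g ∘ (finCongr hk).symm) := by
    intro g
    rw [h1, submatrix_mulVec_equiv]
    rfl
  ext v
  constructor
  · rintro ⟨g, rfl⟩
    exact ⟨_, (h2 g).symm⟩
  · rintro ⟨g, rfl⟩
    refine ⟨g ∘ finCongr hk, (h2 _).trans ?_⟩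
    congr 1

end CompactSVD

end LinearAlgebra

/-! ### Trajectories and observability -/

section Systems

variable {n m p : ℕ}

/-- The matrix of states `[x(0), …, x(c-1)]`. -/
def stateMatrix (c : ℕ) (x : ℕ → Fin n → ℝ) : Matrix (Fin n) (Fin c) ℝ :=
  of fun i j => x j i

/-- A superposition of the columns of the Hankel matrices is again a trajectory; if its input
vanishes, its output is the free response of the superposed initial state. -/
theorem hankel_mulVec_eq_free_response (sys : LTISystem n m p) {L T : ℕ} (hLT : L ≤ T)
    {u : ℕ → Fin m → ℝ} {y : ℕ → Fin p → ℝ} {x : ℕ → Fin n → ℝ}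
    (hx : ∀ k < T, x (k + 1) = sys.A *ᵥ x k + sys.B *ᵥ u k ∧ y k = sys.C *ᵥ x k + sys.D *ᵥ u k)
    {g : Fin (T - L + 1) → ℝ} (hg : hankel L T u *ᵥ g = 0) :
    hankel L T y *ᵥ g = sys.observabilityMatrix L *ᵥ (stateMatrix (T - L + 1) x *ᵥ g) := by
  have hU : ∀ k < L, ∑ j, g j • u (k + j) = 0 := by
    intro k hk
    ext i
    have := congrFun hg (⟨k, hk⟩, i)
    simpa [mulVec, dotProduct, hankel, mul_comm] using this
  have hlin : ∀ {a b : ℕ} (M : Matrix (Fin a) (Fin b) ℝ) (w : ℕ → Fin b → ℝ) (k : ℕ),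
      ∑ j : Fin (T - L + 1), g j • (M *ᵥ w (k + j)) = M *ᵥ ∑ j, g j • w (k + j) := by
    intro a b M w k
    rw [mulVec_sum]
    exact Finset.sum_congr rfl fun j _ => (mulVec_smul _ _ _).symm
  have hX : ∀ k ≤ L, ∑ j : Fin (T - L + 1), g j • x (k + j)
      = (sys.A ^ k) *ᵥ (stateMatrix (T - L + 1) x *ᵥ g) := by
    intro k
    induction k with
    | zero =>
      intro _
      rw [pow_zero, one_mulVec]
      ext i
      simp [mulVec, dotProduct, stateMatrix, mul_comm]
    | succ k ih =>
      intro hk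
      calc ∑ j : Fin (T - L + 1), g j • x (k + 1 + j)
          = ∑ j : Fin (T - L + 1), (g j • (sys.A *ᵥ x (k + j)) + g j • (sys.B *ᵥ u (k + j))) := by
            refine Finset.sum_congr rfl fun j _ => ?_
            rw [← smul_add, ← (hx (k + j) (by omega)).1, add_right_comm]
        _ = _ := by
            rw [Finset.sum_add_distrib, hlin, hlin, hU k (by omega), mulVec_zero, add_zero,
              ih (by omega), mulVec_mulVec, ← pow_succ']
  ext ⟨k, i⟩
  have h1 : ∑ j : Fin (T - L + 1), g j • y (k + j)
      = (sys.C * sys.A ^ (k : ℕ)) *ᵥ (stateMatrix (T - L + 1) x *ᵥ g) := by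
    calc ∑ j : Fin (T - L + 1), g j • y (k + j)
        = ∑ j : Fin (T - L + 1), (g j • (sys.C *ᵥ x (k + j)) + g j • (sys.D *ᵥ u (k + j))) := by
          refine Finset.sum_congr rfl fun j _ => ?_
          rw [← smul_add, ← (hx (k + j) (by omega)).2]
      _ = _ := by
          rw [Finset.sum_add_distrib, hlin, hlin, hU k k.2, mulVec_zero, add_zero,
            hX k k.2.le, mulVec_mulVec]
  have h2 := congrFun h1 i
  calc (hankel L T y *ᵥ g) (k, i) = (∑ j : Fin (T - L + 1), g j • y (k + j)) i := by
        simp [mulVec, dotProduct, hankel, mul_comm]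
    _ = _ := h2

theorem observabilityMatrix_mulVec_eq_zero_iff (sys : LTISystem n m p) (l : ℕ) (v : Fin n → ℝ) :
    sys.observabilityMatrix l *ᵥ v = 0 ↔ ∀ k < l, (sys.C * sys.A ^ k) *ᵥ v = 0 := by
  constructor
  · intro h k hk
    ext i
    exact congrFun h (⟨k, hk⟩, i)
  · intro h
    ext ⟨k, i⟩
    exact congrFun (h k k.2) i

/-- By Cayley-Hamilton, `C Aᵏ` is a combination of `C, C A, …, C Aⁿ⁻¹`. -/
theorem mul_pow_mulVec_eq_zero (sys : LTISystem n m p) {v : Fin n → ℝ}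
    (h : sys.observabilityMatrix n *ᵥ v = 0) (k : ℕ) : (sys.C * sys.A ^ k) *ᵥ v = 0 := by
  rw [observabilityMatrix_mulVec_eq_zero_iff] at h
  rcases Nat.eq_zero_or_pos n with rfl | hn
  · have : v = 0 := Subsingleton.elim _ _
    rw [this, mulVec_zero]
  have hdeg : (Polynomial.X ^ k %ₘ sys.A.charpoly).natDegree < n := by
    have h1 := Polynomial.natDegree_modByMonic_lt (Polynomial.X ^ k) sys.A.charpoly_monic
      (fun h1 => by
        have := sys.A.charpoly_natDegree_eq_dim
        rw [h1, Polynomial.natDegree_one, Fintype.card_fin] at this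
        omega)
    rwa [sys.A.charpoly_natDegree_eq_dim, Fintype.card_fin] at h1
  rw [pow_eq_aeval_mod_charpoly, Polynomial.aeval_eq_sum_range, Matrix.mul_sum, sum_mulVec]
  refine Finset.sum_eq_zero fun i hi => ?_
  rw [Matrix.mul_smul, smul_mulVec, h i (by rw [Finset.mem_range] at hi; omega), smul_zero]

/-- From the lag on, the kernel of the observability matrix is the unobservable subspace. -/
theorem mul_pow_mulVec_eq_zero_of_lag_le (sys : LTISystem n m p) {l : ℕ} (hl : sys.lag ≤ l)
    {v : Fin n → ℝ} (h : sys.observabilityMatrix l *ᵥ v = 0) (k : ℕ) :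
    (sys.C * sys.A ^ k) *ᵥ v = 0 := by
  have hmem : n ∈ {l : ℕ | (sys.observabilityMatrix l).rank = (sys.observabilityMatrix n).rank} :=
    rfl
  have hle : sys.lag ≤ n := Nat.sInf_le hmem
  have hrank : (sys.observabilityMatrix sys.lag).rank = (sys.observabilityMatrix n).rank :=
    Nat.sInf_mem ⟨n, hmem⟩
  have hsub : LinearMap.ker (sys.observabilityMatrix n).mulVecLin
      ≤ LinearMap.ker (sys.observabilityMatrix sys.lag).mulVecLin := by
    intro w hw
    rw [LinearMap.mem_ker, mulVecLin_apply, observabilityMatrix_mulVec_eq_zero_iff] at hw ⊢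
    exact fun k hk => hw k (hk.trans_le hle)
  have heq := Submodule.eq_of_le_of_finrank_eq hsub (by
    have h1 := (sys.observabilityMatrix n).mulVecLin.finrank_range_add_finrank_ker
    have h2 := (sys.observabilityMatrix sys.lag).mulVecLin.finrank_range_add_finrank_ker
    unfold Matrix.rank at hrank
    omega)
  refine mul_pow_mulVec_eq_zero sys ?_ k
  rw [← mulVecLin_apply, ← LinearMap.mem_ker, heq, LinearMap.mem_ker, mulVecLin_apply]
  rw [observabilityMatrix_mulVec_eq_zero_iff] at h ⊢
  exact fun k hk => h k (hk.trans_le hl)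

end Systems

/-! ### Noise-free data matrices -/

section Data

variable {n m p : ℕ} {u : ℕ → Fin m → ℝ} {y : ℕ → Fin p → ℝ}

/-- Up to the effect of the input, the outputs are free responses, which the `n` components of the
initial state parametrize. -/
theorem rank_hankel_mul_one_sub_rowProj_le (sys : LTISystem n m p) {L T : ℕ} (hLT : L ≤ T)
    (h : sys.IsTrajectory T u y) :
    (hankel L T y * (1 - rowProj (hankel L T u))).rank ≤ n := by
  obtain ⟨x, hx⟩ := h
  have : hankel L T y * (1 - rowProj (hankel L T u)) = sys.observabilityMatrix L *
      (stateMatrix (T - L + 1) x * (1 - rowProj (hankel L T u))) := by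
    refine ext_of_mulVec_single fun j => ?_
    rw [← mulVec_mulVec, hankel_mulVec_eq_free_response sys hLT hx (mulVec_one_sub_rowProj _ _),
      ← mulVec_mulVec, ← mulVec_mulVec]
  rw [this]
  exact (rank_mul_le_left _ _).trans
    (by simpa using rank_le_card_width (sys.observabilityMatrix L))

theorem hankelProj_hankel {L T q : ℕ} (w : ℕ → Fin q → ℝ) :
    hankelProj (hankel L T w) = hankel L T w := by
  ext i j
  simp only [hankelProj, of_apply]
  set s := Finset.univ.filter fun q : Fin L × Fin (T - L + 1) => (q.1 : ℕ) + q.2 = i.1 + j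
  have hs : s.Nonempty := ⟨(i.1, j), by simp [s]⟩
  have h1 : ∀ q ∈ s, hankel L T w (q.1, i.2) q.2 = hankel L T w i j := by
    intro q hq
    have : (q.1 : ℕ) + q.2 = i.1 + j := (Finset.mem_filter.mp hq).2
    simp [hankel, this]
  rw [Finset.sum_congr rfl h1, Finset.sum_const, nsmul_eq_mul,
    mul_div_cancel_left₀ _ (Nat.cast_ne_zero.mpr hs.card_ne_zero)]

/-- On exact data the truncated part has rank at most `n`, so no truncation takes place. -/
theorem isSVDStep_hankel_iff (sys : LTISystem n m p) {L T : ℕ} (hLT : L ≤ T)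
    (h : sys.IsTrajectory T u y) (Y : Matrix (Fin L × Fin p) (Fin (T - L + 1)) ℝ) :
    IsSVDStep (rowProj (hankel L T u)) n (hankel L T y) Y ↔ Y = hankel L T y := by
  have key : ∀ S : CompactSVD (hankel L T y * (1 - rowProj (hankel L T u))),
      hankel L T y * rowProj (hankel L T u) + S.truncation n = hankel L T y := by
    intro S
    rw [S.truncation_eq_self (S.r_le_rank.trans (rank_hankel_mul_one_sub_rowProj_le sys hLT h)),
      ← Matrix.mul_add, add_sub_cancel, Matrix.mul_one]
  constructor
  · rintro ⟨S, rfl⟩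
    exact key S
  · rintro rfl
    obtain ⟨S⟩ := exists_compactSVD (hankel L T y * (1 - rowProj (hankel L T u)))
    exact ⟨S, (key S).symm⟩

theorem iterSLRA_hankel_iff (sys : LTISystem n m p) {L T : ℕ} (hLT : L ≤ T)
    (h : sys.IsTrajectory T u y)
    (ν : Seminorm ℝ (Matrix (Fin L × Fin p) (Fin (T - L + 1)) ℝ)) {ε : ℝ} (hε : 0 ≤ ε)
    (Out : Matrix (Fin L × Fin p) (Fin (T - L + 1)) ℝ) :
    IterSLRA ν (rowProj (hankel L T u)) n ε (hankel L T y) Out ↔ Out = hankel L T y := by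
  have hterm : ν (hankelProj (hankel L T y) - hankel L T y)
      ≤ ε * ν (hankelProj (hankel L T y)) := by
    rw [hankelProj_hankel, sub_self, map_zero]
    exact mul_nonneg hε (apply_nonneg ν _)
  constructor
  · intro hit
    cases hit with
    | finish _ _ hstep _ => exact (isSVDStep_hankel_iff sys hLT h _).mp hstep
    | again _ Y _ hstep hns _ =>
      rw [(isSVDStep_hankel_iff sys hLT h _).mp hstep] at hns
      exact absurd hterm hns
  · rintro rfl
    exact .finish _ _ ((isSVDStep_hankel_iff sys hLT h _).mpr rfl) hterm

variable {Tini N T : ℕ}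

theorem eq_zero_of_pastRows_futureRows {a b q : ℕ} {J : Type} [Fintype J]
    {M : Matrix (Fin (a + b) × Fin q) J ℝ} {g : J → ℝ}
    (hP : pastRows M *ᵥ g = 0) (hF : futureRows M *ᵥ g = 0) : M *ᵥ g = 0 := by
  ext ⟨k, i⟩
  induction k using Fin.addCases with
  | left k => exact congrFun hP (k, i)
  | right k => exact congrFun hF (k, i)

/-- Past inputs and outputs and future inputs determine the future outputs: with at least the lag
many past samples, vanishing data force the initial state to be unobservable. -/
theorem toRows₂_mulVec_eq_zero (sys : LTISystem n m p) (hlag : sys.lag ≤ Tini)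
    (hLT : Tini + N ≤ T) (h : sys.IsTrajectory T u y) {g : Fin (T - (Tini + N) + 1) → ℝ}
    (hg : (dataMatrix (Tini := Tini) (N := N) (hankel (Tini + N) T u)
      (hankel (Tini + N) T y)).toRows₁ *ᵥ g = 0) :
    (dataMatrix (Tini := Tini) (N := N) (hankel (Tini + N) T u)
      (hankel (Tini + N) T y)).toRows₂ *ᵥ g = 0 := by
  obtain ⟨x, hx⟩ := h
  have hUP : pastRows (hankel (Tini + N) T u) *ᵥ g = 0 :=
    funext fun i => congrFun hg (.inl i)
  have hYP : pastRows (hankel (Tini + N) T y) *ᵥ g = 0 :=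
    funext fun i => congrFun hg (.inr (.inl i))
  have hUF : futureRows (hankel (Tini + N) T u) *ᵥ g = 0 :=
    funext fun i => congrFun hg (.inr (.inr i))
  have hy := hankel_mulVec_eq_free_response sys hLT hx (eq_zero_of_pastRows_futureRows hUP hUF)
  have hobs : sys.observabilityMatrix Tini *ᵥ (stateMatrix (T - (Tini + N) + 1) x *ᵥ g) = 0 := by
    ext ⟨k, i⟩
    exact (congrFun hy (Fin.castAdd N k, i)).symm.trans (congrFun hYP (k, i))
  have hfree := mul_pow_mulVec_eq_zero_of_lag_le sys hlag hobs
  ext ⟨k, i⟩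
  exact (congrFun hy (Fin.natAdd Tini k, i)).trans (congrFun (hfree _) i)

/-- A trajectory of length `L = Tini + N` is determined by its `m L` input components and its `n`
initial state components. -/
theorem rank_dataMatrix_le (sys : LTISystem n m p) (hLT : Tini + N ≤ T)
    (h : sys.IsTrajectory T u y) :
    (dataMatrix (Tini := Tini) (N := N) (hankel (Tini + N) T u)
      (hankel (Tini + N) T y)).rank ≤ m * (Tini + N) + n := by
  obtain ⟨x, hx⟩ := h
  refine (rank_le_of_ker_le
    (fromRows (hankel (Tini + N) T u) (stateMatrix (T - (Tini + N) + 1) x)) _ ?_).trans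
    ((rank_le_card_height _).trans_eq ?_)
  · intro g hg
    have hU : hankel (Tini + N) T u *ᵥ g = 0 := funext fun i => congrFun hg (.inl i)
    have hX : stateMatrix (T - (Tini + N) + 1) x *ᵥ g = 0 := funext fun i => congrFun hg (.inr i)
    have hY := hankel_mulVec_eq_free_response sys hLT hx hU
    rw [hX, mulVec_zero] at hY
    ext ((⟨k, i⟩ | ⟨k, i⟩ | ⟨k, i⟩) | ⟨k, i⟩)
    · exact congrFun hU (Fin.castAdd N k, i)
    · exact congrFun hY (Fin.castAdd N k, i)
    · exact congrFun hU (Fin.natAdd Tini k, i)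
    · exact congrFun hY (Fin.natAdd Tini k, i)
  · simp [mul_comm]

end Data

/-! ### The unregularized problem without slack -/

section Problem

variable {m p Tini N : ℕ} {J J' : Type} [Fintype J] [Fintype J']

/-- The feasible `(u, y)` of the problem without slack. -/
def feasibleSet (spec : ControlSpec m p Tini) (K : Matrix (Rows m p Tini N) J ℝ) :
    Set ((Fin N → Fin m → ℝ) × (Fin N → Fin p → ℝ)) :=
  {z | ∃ g, IsFeasible spec K g 0 z.1 z.2}

/-- `‖u‖_R² + ‖y‖_Q²`. -/
def controlCost (spec : ControlSpec m p Tini)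
    (z : (Fin N → Fin m → ℝ) × (Fin N → Fin p → ℝ)) : ℝ :=
  quadCost spec.R z.1 + quadCost spec.Q z.2

theorem mem_feasibleSet_iff {spec : ControlSpec m p Tini} {K : Matrix (Rows m p Tini N) J ℝ}
    {z : (Fin N → Fin m → ℝ) × (Fin N → Fin p → ℝ)} :
    z ∈ feasibleSet spec K ↔ (∀ k, z.1 k ∈ spec.U) ∧ (∀ k, z.2 k ∈ spec.Y) ∧
      stacked spec 0 z.1 z.2 ∈ Set.range (K *ᵥ ·) := by
  simp [feasibleSet, IsFeasible]

theorem optimalSet_eq [DecidableEq J] (spec : ControlSpec m p Tini)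
    (K : Matrix (Rows m p Tini N) J ℝ) (lamY : ℝ) :
    optimalSet spec {0} K 0 0 lamY = {z ∈ feasibleSet spec K | IsMinOn (controlCost spec)
      (feasibleSet spec K) z} := by
  have hc : ∀ g (z : (Fin N → Fin m → ℝ) × (Fin N → Fin p → ℝ)),
      cost spec K 0 0 lamY g 0 z.1 z.2 = controlCost spec z := by
    intro g z
    simp [cost, controlCost]
  ext z
  simp only [optimalSet, Set.mem_singleton_iff, exists_eq_left, forall_eq, Set.mem_ofPred_eq,
    isMinOn_iff]
  constructor
  · rintro ⟨g, hg, hmin⟩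
    refine ⟨⟨g, hg⟩, ?_⟩
    rintro z' ⟨g', hg'⟩
    rw [← hc g, ← hc g']
    exact hmin _ _ _ hg'
  · rintro ⟨⟨g, hg⟩, hmin⟩
    refine ⟨g, hg, fun g' u' y' hg' => ?_⟩
    rw [hc g, hc g' (u', y')]
    exact hmin _ ⟨g', hg'⟩

/-- Without regularization, only the column space of the predictor matrix matters. -/
theorem optimalSet_congr [DecidableEq J] [DecidableEq J'] (spec : ControlSpec m p Tini)
    {K : Matrix (Rows m p Tini N) J ℝ}
    {K' : Matrix (Rows m p Tini N) J' ℝ} (h : Set.range (K *ᵥ ·) = Set.range (K' *ᵥ ·))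
    (lamY : ℝ) : optimalSet spec {0} K 0 0 lamY = optimalSet spec {0} K' 0 0 lamY := by
  have : feasibleSet spec K = feasibleSet spec K' := by
    ext z
    rw [mem_feasibleSet_iff, mem_feasibleSet_iff, h]
  rw [optimalSet_eq, optimalSet_eq, this]

theorem quadCost_parallelogram {q : ℕ} (M : Matrix (Fin q) (Fin q) ℝ) (v w : Fin N → Fin q → ℝ) :
    quadCost M v + quadCost M w
      = 2 * quadCost M ((1 / 2 : ℝ) • (v + w)) + 1 / 2 * quadCost M (v - w) := by
  simp only [quadCost, Finset.mul_sum, ← Finset.sum_add_distrib]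
  refine Finset.sum_congr rfl fun k _ => ?_
  simp only [Pi.smul_apply, Pi.add_apply, Pi.sub_apply, mulVec_smul, mulVec_add, mulVec_sub,
    smul_dotProduct, dotProduct_smul, add_dotProduct, dotProduct_add, sub_dotProduct,
    dotProduct_sub, smul_eq_mul]
  ring

theorem quadCost_nonneg {q : ℕ} {M : Matrix (Fin q) (Fin q) ℝ} (hM : M.PosSemidef)
    (v : Fin N → Fin q → ℝ) : 0 ≤ quadCost M v :=
  Finset.sum_nonneg fun k _ => by simpa using hM.dotProduct_mulVec_nonneg (v k)

theorem quadCost_pos {q : ℕ} {M : Matrix (Fin q) (Fin q) ℝ} (hM : M.PosDef)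
    {v : Fin N → Fin q → ℝ} (hv : v ≠ 0) : 0 < quadCost M v := by
  obtain ⟨k, hk⟩ := Function.ne_iff.mp hv
  refine Finset.sum_pos' (fun k _ => ?_) ⟨k, Finset.mem_univ k, ?_⟩
  · simpa using hM.posSemidef.dotProduct_mulVec_nonneg (v k)
  · simpa using hM.dotProduct_mulVec_pos hk

theorem quadCost_smul {q : ℕ} (M : Matrix (Fin q) (Fin q) ℝ) (c : ℝ) (v : Fin N → Fin q → ℝ) :
    quadCost M (c • v) = c ^ 2 * quadCost M v := by
  simp only [quadCost, Finset.mul_sum]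
  refine Finset.sum_congr rfl fun k _ => ?_
  simp only [Pi.smul_apply, mulVec_smul, smul_dotProduct, dotProduct_smul, smul_eq_mul]
  ring

theorem continuous_quadCost {q : ℕ} (M : Matrix (Fin q) (Fin q) ℝ) :
    Continuous (quadCost (N := N) M) := by
  unfold quadCost
  fun_prop

theorem exists_mul_sq_norm_le_quadCost {q : ℕ} {M : Matrix (Fin q) (Fin q) ℝ} (hM : M.PosDef) :
    ∃ κ > 0, ∀ v : Fin N → Fin q → ℝ, κ * ‖v‖ ^ 2 ≤ quadCost M v := by
  obtain ⟨κ, hκ, h⟩ := (isCompact_sphere (0 : Fin N → Fin q → ℝ) 1).exists_forall_le'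
    (continuous_quadCost M).continuousOn (a := 0)
    (fun v hv => quadCost_pos hM (ne_zero_of_mem_unit_sphere ⟨v, hv⟩))
  refine ⟨κ, hκ, fun v => ?_⟩
  rcases eq_or_ne v 0 with rfl | hv
  · simpa using quadCost_nonneg hM.posSemidef _
  · have hn : ‖v‖ ≠ 0 := norm_ne_zero_iff.mpr hv
    have h1 := h (‖v‖⁻¹ • v) (by simp [norm_smul, hn])
    have h2 : quadCost M v = ‖v‖ ^ 2 * quadCost M (‖v‖⁻¹ • v) := by
      rw [quadCost_smul, ← mul_assoc, ← mul_pow, mul_inv_cancel₀ hn, one_pow, one_mul]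
    rw [h2, mul_comm]
    gcongr

variable {spec : ControlSpec m p Tini} {K : Matrix (Rows m p Tini N) J ℝ}

/-- `col(u_ini, y_ini, u)`. -/
def stacked₁ (spec : ControlSpec m p Tini) (u : Fin N → Fin m → ℝ) : Rows₁ m p Tini N → ℝ :=
  Sum.elim (fun i => spec.uIni i.1 i.2)
    (Sum.elim (fun i => spec.yIni i.1 i.2) (fun i => u i.1 i.2))

theorem convex_feasibleSet (hU : Convex ℝ spec.U) (hY : Convex ℝ spec.Y) :
    Convex ℝ (feasibleSet spec K) := by
  rintro z ⟨g, hzU, hzY, hz⟩ z' ⟨g', hzU', hzY', hz'⟩ a b ha hb hab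
  refine ⟨a • g + b • g', fun k => hU (hzU k) (hzU' k) ha hb hab,
    fun k => hY (hzY k) (hzY' k) ha hb hab, ?_⟩
  rw [mulVec_add, mulVec_smul, mulVec_smul, hz, hz']
  ext ((i | i | i) | i)
  · simp [stacked, ← add_mul, hab]
  · simp [stacked, ← add_mul, hab]
  · simp [stacked]
  · simp [stacked]

theorem isClosed_feasibleSet (hU : IsClosed spec.U) (hY : IsClosed spec.Y) :
    IsClosed (feasibleSet spec K) := by
  have hst : Continuous fun z : (Fin N → Fin m → ℝ) × (Fin N → Fin p → ℝ) =>
      stacked spec 0 z.1 z.2 := by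
    refine continuous_pi ?_
    rintro ((i | i | i) | i) <;> simp only [stacked, Sum.elim_inl, Sum.elim_inr] <;> fun_prop
  have hK : IsClosed (Set.range (K *ᵥ ·)) :=
    (LinearMap.range K.mulVecLin).closed_of_finiteDimensional
  have : feasibleSet spec K = (⋂ k, {z | z.1 k ∈ spec.U}) ∩ ((⋂ k, {z | z.2 k ∈ spec.Y}) ∩
      {z | stacked spec 0 z.1 z.2 ∈ Set.range (K *ᵥ ·)}) := by
    ext z
    rw [mem_feasibleSet_iff]
    simp
  rw [this]
  exact (isClosed_iInter fun k => hU.preimage (by fun_prop)).inter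
    ((isClosed_iInter fun k => hY.preimage (by fun_prop)).inter (hK.preimage hst))

/-- If `K₂` vanishes on the kernel of `K₁`, then `y` is an affine function of `u` on the feasible
set. -/
theorem snd_eq_of_mem_feasibleSet [DecidableEq J]
    (hker : ∀ g, K.toRows₁ *ᵥ g = 0 → K.toRows₂ *ᵥ g = 0)
    {z : (Fin N → Fin m → ℝ) × (Fin N → Fin p → ℝ)} (hz : z ∈ feasibleSet spec K) :
    z.2 = fun k i => ((K.toRows₂ * pinv K.toRows₁) *ᵥ stacked₁ spec z.1) (k, i) := by
  obtain ⟨g, -, -, hg⟩ := hz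
  have h1 : K.toRows₁ *ᵥ g = stacked₁ spec z.1 := by
    ext i
    refine (congrFun hg (.inl i)).trans ?_
    rcases i with i | i | i <;> simp [stacked, stacked₁]
  have h2 : K.toRows₂ *ᵥ g = fun i => z.2 i.1 i.2 := funext fun i => congrFun hg (.inr i)
  rw [← h1, mulVec_mulVec, Matrix.mul_assoc, ← rowProj, mul_rowProj_of_ker_le _ _ hker, h2]

theorem subsingleton_optimalSet [DecidableEq J] (hR : spec.R.PosDef) (hQ : spec.Q.PosSemidef)
    (hU : Convex ℝ spec.U) (hY : Convex ℝ spec.Y)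
    (hker : ∀ g, K.toRows₁ *ᵥ g = 0 → K.toRows₂ *ᵥ g = 0) (lamY : ℝ) :
    (optimalSet spec {0} K 0 0 lamY).Subsingleton := by
  rw [optimalSet_eq]
  rintro z ⟨hz, hzmin⟩ w ⟨hw, hwmin⟩
  have hmid : (1 / 2 : ℝ) • (z + w) ∈ feasibleSet spec K := by
    rw [smul_add]
    exact convex_feasibleSet hU hY hz hw (by norm_num) (by norm_num) (by norm_num)
  have h1 := isMinOn_iff.mp hzmin _ hmid
  have h2 := isMinOn_iff.mp hwmin _ hmid
  have h3 := quadCost_parallelogram spec.R z.1 w.1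
  have h4 := quadCost_parallelogram spec.Q z.2 w.2
  have h5 := quadCost_nonneg hQ (z.2 - w.2)
  simp only [controlCost, Prod.smul_fst, Prod.smul_snd, Prod.fst_add, Prod.snd_add] at h1 h2
  have hu : z.1 = w.1 := by
    by_contra hne
    have := quadCost_pos hR (sub_ne_zero.mpr hne)
    linarith
  refine Prod.ext hu ?_
  rw [snd_eq_of_mem_feasibleSet hker hz, snd_eq_of_mem_feasibleSet hker hw, hu]

theorem optimalSet_nonempty [DecidableEq J] (hR : spec.R.PosDef) (hQ : spec.Q.PosSemidef)
    (hU : IsClosed spec.U) (hY : IsClosed spec.Y)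
    (hker : ∀ g, K.toRows₁ *ᵥ g = 0 → K.toRows₂ *ᵥ g = 0) (lamY : ℝ)
    (hne : (feasibleSet spec K).Nonempty) :
    (optimalSet spec {0} K 0 0 lamY).Nonempty := by
  rw [optimalSet_eq]
  -- the cost need not be coercive in `y`, so the minimization is carried out over `u` alone
  let φ : (Fin N → Fin m → ℝ) → (Fin N → Fin m → ℝ) × (Fin N → Fin p → ℝ) := fun u =>
    (u, fun k i => ((K.toRows₂ * pinv K.toRows₁) *ᵥ stacked₁ spec u) (k, i))
  have hφ : Continuous φ := by
    have : Continuous (stacked₁ (N := N) spec) := by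
      refine continuous_pi ?_
      rintro (i | i | i) <;> simp only [stacked₁, Sum.elim_inl, Sum.elim_inr] <;> fun_prop
    fun_prop
  have hmem : ∀ z ∈ feasibleSet spec K, φ z.1 = z := fun z hz =>
    Prod.ext rfl (snd_eq_of_mem_feasibleSet hker hz).symm
  have hcont : Continuous fun u => controlCost spec (φ u) :=
    ((continuous_quadCost spec.R).comp (continuous_fst.comp hφ)).add
      ((continuous_quadCost spec.Q).comp (continuous_snd.comp hφ))
  obtain ⟨κ, hκ, hbound⟩ := exists_mul_sq_norm_le_quadCost (N := N) hR
  have hlim : Filter.Tendsto (fun u => controlCost spec (φ u)) (Filter.cocompact _)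
      Filter.atTop := by
    refine Filter.tendsto_atTop_mono
      (fun u => (hbound u).trans (le_add_of_nonneg_right (quadCost_nonneg hQ _))) ?_
    exact (((Filter.tendsto_pow_atTop two_ne_zero).comp
      (tendsto_norm_cocompact_atTop)).const_mul_atTop hκ)
  obtain ⟨z₀, hz₀⟩ := hne
  obtain ⟨u, hu, hmin⟩ := hcont.continuousOn.exists_isMinOn'
    ((isClosed_feasibleSet (K := K) hU hY).preimage hφ) (x₀ := z₀.1)
    (by rw [Set.mem_preimage, hmem z₀ hz₀]; exact hz₀)
    ((hlim.eventually_ge_atTop _).filter_mono inf_le_left)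
  refine ⟨φ u, hu, isMinOn_iff.mpr fun z hz => ?_⟩
  have := isMinOn_iff.mp hmin z.1 (by rw [Set.mem_preimage, hmem z hz]; exact hz)
  rwa [hmem z hz] at this

theorem spcMatrix_eq_self [DecidableEq J] (hker : ∀ g, K.toRows₁ *ᵥ g = 0 → K.toRows₂ *ᵥ g = 0) :
    spcMatrix K = K := by
  rw [spcMatrix, mul_rowProj_of_ker_le _ _ hker, fromRows_toRows]

end Problem

end DeePC

theorem fact1 {n m p Tini N T : ℕ} (hN : 0 < N)
    (sys : DeePC.LTISystem n m p) (hctrl : sys.IsControllable) (hlag : sys.lag ≤ Tini)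
    -- noise-free offline data, with persistently exciting input
    (ud : ℕ → Fin m → ℝ) (yd : ℕ → Fin p → ℝ) (htraj : sys.IsTrajectory T ud yd)
    (hpe : DeePC.PersistentlyExciting (Tini + N + n) T ud)
    -- control specification
    (spec : DeePC.ControlSpec m p Tini) (hR : spec.R.PosDef) (hQ : spec.Q.PosSemidef)
    (hU : Convex ℝ spec.U) (hY : Convex ℝ spec.Y) (lamY : ℝ)
    -- the data matrices
    (Hu : Matrix (Fin (Tini + N) × Fin m) (Fin (T - (Tini + N) + 1)) ℝ)
    (hHu : Hu = DeePC.hankel (Tini + N) T ud)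
    (Hy : Matrix (Fin (Tini + N) × Fin p) (Fin (T - (Tini + N) + 1)) ℝ)
    (hHy : Hy = DeePC.hankel (Tini + N) T yd)
    (H : Matrix (DeePC.Rows m p Tini N) (Fin (T - (Tini + N) + 1)) ℝ)
    (hH : H = DeePC.dataMatrix Hu Hy)
    -- norm and tolerance of the stopping test in the iterative low-rank approximation
    (ν : Seminorm ℝ (Matrix (Fin (Tini + N) × Fin p) (Fin (T - (Tini + N) + 1)) ℝ))
    (ε : ℝ) (hε : 0 ≤ ε) :
    -- the iterative low-rank approximation has an output
    (∃ Hys, DeePC.IterSLRA ν (DeePC.rowProj Hu) n ε Hy Hys) ∧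
    ∃ sol : Set ((Fin N → Fin m → ℝ) × (Fin N → Fin p → ℝ)),
      -- all problems have the same optimal `(u, y)`, whatever decompositions are used
      DeePC.hybridSol spec {0} H 0 0 lamY = sol ∧
      (∀ S : DeePC.CompactSVD H, DeePC.svdSol spec {0} S 0 0 lamY = sol) ∧
      DeePC.spcSol spec {0} H 0 lamY = sol ∧
      (∀ Hys, DeePC.IterSLRA ν (DeePC.rowProj Hu) n ε Hy Hys →
        ∀ S : DeePC.CompactSVD (DeePC.dataMatrix (Tini := Tini) (N := N) Hu Hys),
          DeePC.svdIterSol n spec {0} S 0 lamY = sol) ∧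
      -- there is at most one, and exactly one if the constraint sets are closed and the
      -- (common) constraints can be met
      sol.Subsingleton ∧
      (IsClosed spec.U → IsClosed spec.Y →
        (∃ g u y, DeePC.IsFeasible spec H g 0 u y) → ∃ z, sol = {z}) := by
  subst hHu hHy hH
  have hLT : Tini + N ≤ T := by
    have := hpe.1
    omega
  have hiter := DeePC.iterSLRA_hankel_iff sys hLT htraj ν hε
  have hker := fun g => DeePC.toRows₂_mulVec_eq_zero (g := g) sys hlag hLT htraj
  have hsub := DeePC.subsingleton_optimalSet hR hQ hU hY hker lamY
  refine ⟨⟨_, (hiter _).mpr rfl⟩, _, rfl, fun S => ?_, ?_, ?_, hsub, ?_⟩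
  · exact DeePC.optimalSet_congr spec S.range_factor lamY
  · rw [DeePC.spcSol, DeePC.spcMatrix_eq_self hker, DeePC.hybridSol]
  · intro Hys hHys
    obtain rfl := (hiter Hys).mp hHys
    exact fun S => DeePC.optimalSet_congr spec (S.range_leadingFactor
      (S.r_le_rank.trans (DeePC.rank_dataMatrix_le sys hLT htraj))) lamY
  · rintro hUc hYc ⟨g, u, y, hg⟩
    have hne := DeePC.optimalSet_nonempty hR hQ hUc hYc hker lamY ⟨(u, y), g, hg⟩
    exact Set.exists_eq_singleton_iff_nonempty_subsingleton.mpr ⟨hne, hsub⟩
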